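/- Let $n\ge 1$. An input is a finite nonempty multiset $X=\{x_1,\dots,x_N\}$ of points of $\mathbb{R}^n$ together with labels $\ell:X\to\{\pm1\}$ (a label depends only on the point; $|X|=N$ and all counts are with multiplicity). A halfspace is a function $h(x)=\operatorname{sign}(w_0+\sum_{i=1}^n w_ix_i)$ with $w_0,\dots,w_n\in\mathbb{R}$, and $\ell$ is realizable by a halfspace if some halfspace $h$ has $h(x)=\ell(x)$ for all $x\in X$. (Equivalently, the system of linear constraints $\ell(x)\,(w_0+\sum_i w_ix_i)\ge 1$, $x\in X$, in the unknowns $w_0,\dots,w_n$ is feasible.) A two-sided $\varepsilon$-tester with $m$ samples is a randomized algorithm, which may depend on $n,\varepsilon$ and $|X|$, that receives $m$ labelled points $(x,\ell(x))$ (equivalently, constraints), each drawn independently and uniformly from $X$, outputs $0$ or $1$, and for every input satisfies: 1. if $\ell$ is realizable by a halfspace, it outputs $1$ with probability at least $2/3$; 2. if at least $\varepsilon|X|$ labels must be changed for the labelling to become realizable by a halfspace, it outputs $0$ with probability at least $2/3$. **Theorem.** There are a constant $\varepsilon_0>0$ and a function $\gamma:\mathbb{N}\to\mathbb{R}$ with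 $\gamma(n)\to0$ as $n\to\infty$ such that, for all sufficiently large $n$ and all $0<\varepsilon\le\varepsilon_0$, every two-sided $\varepsilon$-tester in $\mathbb{R}^n$ uses at least $n^{1-\gamma(n)}=n^{1-o(1)}$ samples. The same bound holds for testers that are required to be correct only on inputs in which $X$ is a genuine set (no repeated points), i.e. when the samples are uniform over an unknown finite set. -/

import Mathlib

open Filter Topology

/-- The halfspace `x ↦ sign (w₀ + ∑ i, wᵢ xᵢ)` on `ℝⁿ`, with values in `{±1}` and `sign 0 = 1`.
(On a finite set of points the choice of `sign 0` does not affect which labellings arise.) -/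
noncomputable def halfspace {n : ℕ} (w₀ : ℝ) (w : Fin n → ℝ) (x : Fin n → ℝ) : ℤˣ :=
  if 0 ≤ w₀ + ∑ i, w i * x i then 1 else -1

/-- The labels `ℓ` of the points `x 0, …, x (N - 1)` are realizable by a halfspace. -/
def Realizable {n N : ℕ} (x : Fin N → (Fin n → ℝ)) (ℓ : (Fin n → ℝ) → ℤˣ) : Prop :=
  ∃ (w₀ : ℝ) (w : Fin n → ℝ), ∀ i, halfspace w₀ w (x i) = ℓ (x i)

/-- At least `ε * N` of the labels of the points `x 0, …, x (N - 1)`, counted with multiplicity,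
must be changed before they become realizable by a halfspace. -/
def FarFromRealizable {n N : ℕ} (ε : ℝ) (x : Fin N → (Fin n → ℝ)) (ℓ : (Fin n → ℝ) → ℤˣ) : Prop :=
  ∀ ℓ' : (Fin n → ℝ) → ℤˣ, Realizable x ℓ' →
    ε * N ≤ ((Finset.univ.filter fun i : Fin N => ℓ' (x i) ≠ ℓ (x i)).card : ℝ)

/-- A (randomized) decision rule that sees `m` labelled points of `ℝⁿ`, given by the probability
with which it outputs `1` on each possible sequence of `m` labelled points.  The labelled point
`(y, b)` stands for the linear constraint `b * (w₀ + ∑ i, wᵢ yᵢ) ≥ 1` in the unknowns `w₀, w`. -/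
abbrev DecisionRule (n m : ℕ) : Type := (Fin m → (Fin n → ℝ) × ℤˣ) → Set.Icc (0 : ℝ) 1

/-- The probability that the rule `A` outputs `1` when its `m` samples are drawn independently and
uniformly, with replacement, from the multiset of labelled points `(x i, ℓ (x i))`, `i < N`:
the average over all `N ^ m` sequences of indices. -/
noncomputable def acceptProb {n m N : ℕ} (A : DecisionRule n m)
    (x : Fin N → (Fin n → ℝ)) (ℓ : (Fin n → ℝ) → ℤˣ) : ℝ :=
  (∑ j : Fin m → Fin N, (A (fun k => (x (j k), ℓ (x (j k)))) : ℝ)) / (N : ℝ) ^ m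

/-- `A` is a two-sided `ε`-tester with `m` samples for realizability by a halfspace, on all
nonempty multisets of points `x 0, …, x (N - 1)` that belong to the class `C`.  The tester may
depend on the number `N` of points. -/
def IsTester {n m : ℕ} (C : (N : ℕ) → Set (Fin N → (Fin n → ℝ))) (ε : ℝ)
    (A : ℕ → DecisionRule n m) : Prop :=
  ∀ N : ℕ, 0 < N → ∀ x ∈ C N, ∀ ℓ : (Fin n → ℝ) → ℤˣ,
    (Realizable x ℓ → 2 / 3 ≤ acceptProb (A N) x ℓ) ∧
    (FarFromRealizable ε x ℓ → 2 / 3 ≤ 1 - acceptProb (A N) x ℓ)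

/-- All finite multisets of points of `ℝⁿ`. -/
def pointMultisets (n : ℕ) (N : ℕ) : Set (Fin N → (Fin n → ℝ)) := Set.univ

/-- All finite sets of points of `ℝⁿ`: multisets without repeated points. -/
def pointSets (n : ℕ) (N : ℕ) : Set (Fin N → (Fin n → ℝ)) := {x | Function.Injective x}

/-- The self-maps of `Fin L` all of whose nonempty fibres have exactly `v` elements. -/
def regularMaps (L v : ℕ) : Finset (Fin L → Fin L) :=
  Finset.univ.filter fun f => ∀ s, (Finset.univ.filter fun s' => f s' = f s).card = v

/-- The maps in `regularMaps L v` that agree with `g` on `T`. -/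
def regularExtensions (L v : ℕ) (T : Finset (Fin L)) (g : Fin L → Fin L) :
    Finset (Fin L → Fin L) :=
  (regularMaps L v).filter fun f => ∀ s ∈ T, f s = g s

theorem mem_regularMaps {L v : ℕ} {f : Fin L → Fin L} : f ∈ regularMaps L v ↔
    ∀ s, (Finset.univ.filter fun s' => f s' = f s).card = v := by
  simp [regularMaps]

theorem mem_regularExtensions {L v : ℕ} {T : Finset (Fin L)} {g f : Fin L → Fin L} :
    f ∈ regularExtensions L v T g ↔ f ∈ regularMaps L v ∧ ∀ s ∈ T, f s = g s := by
  simp [regularExtensions]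

theorem perm_comp_comp_perm_mem_regularMaps {L v : ℕ} {f : Fin L → Fin L}
    (σ τ : Equiv.Perm (Fin L)) (hf : f ∈ regularMaps L v) :
    (fun x => σ (f (τ x))) ∈ regularMaps L v := by
  rw [mem_regularMaps] at hf ⊢
  intro s
  rw [← hf (τ s)]
  refine Finset.card_equiv τ fun x => ?_
  simp

/-- Replacing a free point and its value by another free point and value does not change the
number of regular extensions. -/
theorem card_filter_regularExtensions_eq {L v : ℕ} {T : Finset (Fin L)} {g : Fin L → Fin L}
    {s s' : Fin L} (hs : s ∉ T) (hs' : s' ∉ T) (σ : Equiv.Perm (Fin L))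
    (hσ : ∀ t ∈ T, σ (g t) = g t) (c : Fin L) :
    ((regularExtensions L v T g).filter fun f => f s' = σ c).card =
      ((regularExtensions L v T g).filter fun f => f s = c).card := by
  have key : ∀ (σ : Equiv.Perm (Fin L)) (_ : ∀ t ∈ T, σ (g t) = g t) (s s' c : Fin L)
      (_ : s ∉ T) (_ : s' ∉ T),
      ((regularExtensions L v T g).filter fun f => f s = c).card ≤
        ((regularExtensions L v T g).filter fun f => f s' = σ c).card := by
    intro σ hσ s s' c hs hs'
    refine Finset.card_le_card_of_injOn (fun f x => σ (f (Equiv.swap s s' x))) ?_ ?_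
    · intro f hf
      simp only [Finset.coe_filter, Set.mem_ofPred_eq, mem_regularExtensions] at hf ⊢
      obtain ⟨⟨h1, h2⟩, h3⟩ := hf
      refine ⟨⟨perm_comp_comp_perm_mem_regularMaps σ (Equiv.swap s s') h1, ?_⟩, ?_⟩
      · intro t ht
        rw [Equiv.swap_apply_of_ne_of_ne, h2 t ht, hσ t ht]
        · rintro rfl; exact hs ht
        · rintro rfl; exact hs' ht
      · simp [h3]
    · intro f _ f' _ h
      funext x
      have := congrFun h (Equiv.swap s s' x)
      simpa using this
  refine le_antisymm ?_ (key σ hσ s s' c hs hs')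
  have := key σ⁻¹ (fun t ht => by rw [Equiv.Perm.inv_eq_iff_eq, hσ t ht]) s' s (σ c) hs' hs
  simpa using this

theorem card_regularExtensions_insert {L v : ℕ} (T : Finset (Fin L)) (g : Fin L → Fin L)
    (s : Fin L) :
    (regularExtensions L v (insert s T) g).card =
      ((regularExtensions L v T g).filter fun f => f s = g s).card := by
  congr 1
  ext f
  simp only [mem_regularExtensions, Finset.mem_filter, Finset.forall_mem_insert]
  tauto

theorem card_regularExtensions_insert_of_mem_image {L v : ℕ} {T : Finset (Fin L)}
    {g : Fin L → Fin L} {s : Fin L} (hs : s ∉ T) (hg : g s ∈ T.image g) :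
    ((Tᶜ.card : ℕ) : ℝ) * (regularExtensions L v (insert s T) g).card =
      ((v : ℝ) - (T.filter fun t => g t = g s).card) * (regularExtensions L v T g).card := by
  have h := Finset.sum_card_bipartiteAbove_eq_sum_card_bipartiteBelow
    (fun (x : Fin L) (f : Fin L → Fin L) => f x = g s) (s := Tᶜ) (t := regularExtensions L v T g)
  have h1 : ∀ x ∈ Tᶜ, ((regularExtensions L v T g).bipartiteAbove
      (fun (x : Fin L) (f : Fin L → Fin L) => f x = g s) x).card =
      (regularExtensions L v (insert s T) g).card := by
    intro x hx
    rw [card_regularExtensions_insert]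
    exact card_filter_regularExtensions_eq (v := v) (g := g) hs (Finset.mem_compl.1 hx) 1
      (fun _ _ => rfl) (g s)
  have h2 : ∀ f ∈ regularExtensions L v T g, ((Finset.bipartiteBelow
      (fun (x : Fin L) (f : Fin L → Fin L) => f x = g s) Tᶜ f).card : ℝ) =
      (v : ℝ) - (T.filter fun t => g t = g s).card := by
    intro f hf
    rw [mem_regularExtensions, mem_regularMaps] at hf
    obtain ⟨t₀, ht₀, hgt⟩ := Finset.mem_image.1 hg
    have e1 := hf.1 t₀
    rw [hf.2 t₀ ht₀, hgt] at e1
    have e2 : (T.filter fun t => g t = g s) = T.filter fun t => f t = g s :=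
      Finset.filter_congr fun t ht => by rw [hf.2 t ht]
    rw [e2, ← e1, eq_sub_iff_add_eq, ← Nat.cast_add, Finset.bipartiteBelow,
      ← Finset.card_union_of_disjoint, ← Finset.filter_union]
    · rw [Finset.union_comm, Finset.union_compl]
    · exact Finset.disjoint_filter_filter (disjoint_compl_left)
  rw [Finset.sum_congr rfl h1, Finset.sum_const, smul_eq_mul] at h
  rw [← Nat.cast_mul, h, Nat.cast_sum, Finset.sum_congr rfl h2, Finset.sum_const, nsmul_eq_mul,
    mul_comm]

theorem card_regularExtensions_insert_of_notMem_image {L v : ℕ} {T : Finset (Fin L)}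
    {g : Fin L → Fin L} {s : Fin L} (hs : s ∉ T) (hg : g s ∉ T.image g) :
    ((Tᶜ.card * (T.image g)ᶜ.card : ℕ) : ℝ) * (regularExtensions L v (insert s T) g).card =
      ((L : ℝ) - (T.image g).card * v) * (regularExtensions L v T g).card := by
  have h := Finset.sum_card_bipartiteAbove_eq_sum_card_bipartiteBelow
    (fun (x : Fin L × Fin L) (f : Fin L → Fin L) => f x.1 = x.2) (s := Tᶜ ×ˢ (T.image g)ᶜ)
    (t := regularExtensions L v T g)
  have h1 : ∀ x ∈ Tᶜ ×ˢ (T.image g)ᶜ, ((regularExtensions L v T g).bipartiteAbove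
      (fun (x : Fin L × Fin L) (f : Fin L → Fin L) => f x.1 = x.2) x).card =
      (regularExtensions L v (insert s T) g).card := by
    intro x hx
    rw [Finset.mem_product, Finset.mem_compl, Finset.mem_compl] at hx
    rw [card_regularExtensions_insert]
    have := card_filter_regularExtensions_eq (v := v) hs hx.1 (Equiv.swap (g s) x.2) (g := g)
      (fun t ht => Equiv.swap_apply_of_ne_of_ne
        (fun h => hg (h ▸ Finset.mem_image_of_mem g ht))
        (fun h => hx.2 (h ▸ Finset.mem_image_of_mem g ht))) (g s)
    rw [Equiv.swap_apply_left] at this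
    exact this
  have h2 : ∀ f ∈ regularExtensions L v T g, ((Finset.bipartiteBelow
      (fun (x : Fin L × Fin L) (f : Fin L → Fin L) => f x.1 = x.2) (Tᶜ ×ˢ (T.image g)ᶜ) f).card : ℝ)
      = (L : ℝ) - (T.image g).card * v := by
    intro f hf
    rw [mem_regularExtensions, mem_regularMaps] at hf
    have e1 : (Finset.bipartiteBelow (fun (x : Fin L × Fin L) (f : Fin L → Fin L) => f x.1 = x.2)
        (Tᶜ ×ˢ (T.image g)ᶜ) f).card = (Finset.univ.filter fun x => f x ∉ T.image g).card := by
      refine Finset.card_bij' (fun x _ => x.1) (fun x _ => (x, f x)) ?_ ?_ ?_ ?_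
      · rintro ⟨x, y⟩ hx
        simp only [Finset.mem_bipartiteBelow, Finset.mem_product, Finset.mem_compl] at hx
        simp only [Finset.mem_filter, Finset.mem_univ, true_and]
        rw [hx.2]; exact hx.1.2
      · intro x hx
        simp only [Finset.mem_filter, Finset.mem_univ, true_and] at hx
        simp only [Finset.mem_bipartiteBelow, Finset.mem_product, Finset.mem_compl, and_true]
        refine ⟨fun hT => hx ?_, hx⟩
        rw [hf.2 x hT]; exact Finset.mem_image_of_mem g hT
      · rintro ⟨x, y⟩ hx
        simp only [Finset.mem_bipartiteBelow] at hx
        simp [hx.2]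
      · intro x _; rfl
    have e2 : (Finset.univ.filter fun x => f x ∈ T.image g).card = (T.image g).card * v := by
      rw [Finset.card_eq_sum_card_fiberwise (f := f) (t := T.image g)
        (fun x hx => by simpa using hx), Finset.sum_const_nat]
      intro c hc
      obtain ⟨t, ht, rfl⟩ := Finset.mem_image.1 hc
      rw [← hf.1 t, Finset.filter_filter]
      congr 1
      ext x
      simp only [Finset.mem_filter, Finset.mem_univ, true_and, hf.2 t ht]
      exact ⟨fun h => h.2, fun h => ⟨h ▸ hc, h⟩⟩
    have e3 := Finset.card_filter_add_card_filter_not (s := (Finset.univ : Finset (Fin L)))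
      (fun x => f x ∈ T.image g)
    rw [e2, Finset.card_univ, Fintype.card_fin] at e3
    rw [e1, eq_sub_iff_add_eq]
    exact_mod_cast (by omega)
  rw [Finset.sum_congr rfl h1, Finset.sum_const, smul_eq_mul, Finset.card_product] at h
  rw [← Nat.cast_mul, h, Nat.cast_sum, Finset.sum_congr rfl h2, Finset.sum_const, nsmul_eq_mul,
    mul_comm]

/-- The proportion of maps in `regularMaps L v` that agree with `g` on `T` is a polynomial in `v`
of degree at most `T.card`. -/
theorem exists_polynomial_card_regularExtensions {L : ℕ} (T : Finset (Fin L))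
    (g : Fin L → Fin L) : ∃ p : Polynomial ℝ, p.natDegree ≤ T.card ∧
      ∀ v : ℕ, ((regularExtensions L v T g).card : ℝ) = p.eval (v : ℝ) * (regularMaps L v).card := by
  induction T using Finset.induction_on with
  | empty => exact ⟨1, by simp, fun v => by simp [regularExtensions]⟩
  | insert s T hs ih =>
    obtain ⟨p, hp, hv⟩ := ih
    have hT : ((Tᶜ.card : ℕ) : ℝ) ≠ 0 := by
      rw [Nat.cast_ne_zero, Finset.card_ne_zero]
      exact ⟨s, Finset.mem_compl.2 hs⟩
    rw [Finset.card_insert_of_notMem hs]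
    by_cases hg : g s ∈ T.image g
    · refine ⟨Polynomial.C (Tᶜ.card : ℝ)⁻¹ *
        (Polynomial.X - Polynomial.C ((T.filter fun t => g t = g s).card : ℝ)) * p, ?_, ?_⟩
      · refine Polynomial.natDegree_mul_le.trans ?_
        have : (Polynomial.C (Tᶜ.card : ℝ)⁻¹ *
          (Polynomial.X - Polynomial.C ((T.filter fun t => g t = g s).card : ℝ))).natDegree ≤ 1 :=
          (Polynomial.natDegree_C_mul_le _ _).trans (Polynomial.natDegree_X_sub_C_le _)
        omega
      · intro v
        have h := card_regularExtensions_insert_of_mem_image (v := v) hs hg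
        rw [hv] at h
        simp only [Polynomial.eval_mul, Polynomial.eval_C, Polynomial.eval_sub, Polynomial.eval_X]
        rw [mul_assoc, mul_assoc, eq_inv_mul_iff_mul_eq₀ hT, h]
    · have hT' : ((Tᶜ.card * (T.image g)ᶜ.card : ℕ) : ℝ) ≠ 0 := by
        rw [Nat.cast_mul]
        refine mul_ne_zero hT ?_
        rw [Nat.cast_ne_zero, Finset.card_ne_zero]
        exact ⟨g s, Finset.mem_compl.2 hg⟩
      refine ⟨Polynomial.C ((Tᶜ.card * (T.image g)ᶜ.card : ℕ) : ℝ)⁻¹ *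
        (Polynomial.C (L : ℝ) - Polynomial.C ((T.image g).card : ℝ) * Polynomial.X) * p, ?_, ?_⟩
      · refine Polynomial.natDegree_mul_le.trans ?_
        have : (Polynomial.C ((Tᶜ.card * (T.image g)ᶜ.card : ℕ) : ℝ)⁻¹ *
            (Polynomial.C (L : ℝ) - Polynomial.C ((T.image g).card : ℝ) *
              Polynomial.X)).natDegree ≤ 1 := by
          refine (Polynomial.natDegree_C_mul_le _ _).trans
            ((Polynomial.natDegree_sub_le _ _).trans (max_le (by simp) ?_))
          exact (Polynomial.natDegree_C_mul_le _ _).trans Polynomial.natDegree_X_le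
        omega
      · intro v
        have h := card_regularExtensions_insert_of_notMem_image (v := v) hs hg
        rw [hv] at h
        simp only [Polynomial.eval_mul, Polynomial.eval_C, Polynomial.eval_sub, Polynomial.eval_X]
        rw [mul_assoc, mul_assoc, eq_inv_mul_iff_mul_eq₀ hT', h]

theorem regularMaps_nonempty {L v : ℕ} (hv : 0 < v) (h : v ∣ L) : (regularMaps L v).Nonempty := by
  obtain ⟨w, rfl⟩ := h
  refine ⟨fun s => ⟨s / v, (Nat.div_le_self _ _).trans_lt s.2⟩, ?_⟩
  rw [mem_regularMaps]
  intro s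
  have hs : (s : ℕ) / v < w := Nat.div_lt_of_lt_mul s.2
  have hle : (s : ℕ) / v * v + v ≤ v * w := by nlinarith
  have : (Finset.Ico ((s : ℕ) / v * v) ((s : ℕ) / v * v + v)).card = v := by simp
  refine Eq.trans ?_ this
  refine Finset.card_bij (fun x _ => (x : ℕ)) ?_ ?_ ?_
  · intro x hx
    simp only [Finset.mem_filter, Finset.mem_univ, true_and, Fin.mk.injEq] at hx
    rw [Finset.mem_Ico, ← hx]
    exact ⟨Nat.div_mul_le_self _ _, Nat.lt_div_mul_add hv⟩
  · intro x _ y _ h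
    exact Fin.ext h
  · intro x hx
    rw [Finset.mem_Ico] at hx
    refine ⟨⟨x, hx.2.trans_le hle⟩, ?_, rfl⟩
    simp only [Finset.mem_filter, Finset.mem_univ, true_and, Fin.mk.injEq]
    exact Nat.div_eq_of_lt_le hx.1 (by linarith)

theorem injective_of_mem_regularMaps_one {L : ℕ} {f : Fin L → Fin L}
    (hf : f ∈ regularMaps L 1) : Function.Injective f := by
  rw [mem_regularMaps] at hf
  intro a b h
  exact Finset.card_le_one.1 (hf b).le a (by simpa using h) b (by simp)

theorem card_image_mul_of_mem_regularMaps {L v : ℕ} {f : Fin L → Fin L}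
    (hf : f ∈ regularMaps L v) : (Finset.univ.image f).card * v = L := by
  rw [mem_regularMaps] at hf
  have := Finset.card_eq_sum_card_image f Finset.univ
  rw [Finset.sum_const_nat (m := v), Finset.card_univ, Fintype.card_fin] at this
  · exact this.symm
  · intro c hc
    obtain ⟨s, _, rfl⟩ := Finset.mem_image.1 hc
    exact hf s

theorem half_le_prod_one_sub_pow (r : ℕ) :
    (1 + (1 / 64 : ℝ) ^ r) / 2 ≤ ∏ t ∈ Finset.range r, (1 - (1 / 64 : ℝ) ^ (t + 1)) := by
  induction r with
  | zero => simp
  | succ r ih =>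
    rw [Finset.prod_range_succ]
    have h0 : (0 : ℝ) < (1 / 64 : ℝ) ^ r := by positivity
    have h1 : (1 / 64 : ℝ) ^ r ≤ 1 := pow_le_one₀ (by norm_num) (by norm_num)
    rw [pow_succ]
    set y := (1 / 64 : ℝ) ^ r
    have := mul_le_mul_of_nonneg_right ih (by linarith : 0 ≤ 1 - y * (1 / 64))
    nlinarith

/-- The normalized divided difference coefficient at the node `64 ^ j` with respect to the nodes
`64 ^ i`, `i < K`. -/
noncomputable def nodeCoeff (K j : ℕ) : ℝ :=
  (∏ i ∈ (Finset.range K).erase 0, ((64 : ℝ) ^ 0 - 64 ^ i)) /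
    ∏ i ∈ (Finset.range K).erase j, ((64 : ℝ) ^ j - 64 ^ i)

theorem sum_nodeCoeff_mul_eval {K : ℕ} {p : Polynomial ℝ} (hp : p.natDegree + 1 < K) :
    ∑ j ∈ Finset.range K, nodeCoeff K j * p.eval ((64 : ℝ) ^ j) = 0 := by
  have hinj : Set.InjOn (fun i : ℕ => (64 : ℝ) ^ i) (Finset.range K : Set ℕ) :=
    (pow_right_injective₀ (by norm_num) (by norm_num)).injOn
  have hdeg : p.degree < ((Finset.range K).card : WithBot ℕ) := by
    rw [Finset.card_range]
    exact Polynomial.degree_le_natDegree.trans_lt (by exact_mod_cast (by omega))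
  have h := Lagrange.coeff_eq_sum hinj hdeg
  rw [Finset.card_range, Polynomial.coeff_eq_zero_of_natDegree_lt (by omega)] at h
  have h2 : ∑ j ∈ Finset.range K, nodeCoeff K j * p.eval ((64 : ℝ) ^ j) =
      (∏ i ∈ (Finset.range K).erase 0, ((64 : ℝ) ^ 0 - 64 ^ i)) *
        ∑ j ∈ Finset.range K, p.eval ((64 : ℝ) ^ j) /
          ∏ i ∈ (Finset.range K).erase j, ((64 : ℝ) ^ j - 64 ^ i) := by
    rw [Finset.mul_sum]
    refine Finset.sum_congr rfl fun j _ => ?_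
    rw [nodeCoeff]; ring
  rw [h2, ← h, mul_zero]

theorem nodeCoeff_zero (K : ℕ) : nodeCoeff K 0 = 1 := by
  refine div_self (Finset.prod_ne_zero_iff.2 fun i hi => ?_)
  rw [sub_ne_zero]
  exact fun h => (Finset.mem_erase.1 hi).1
    (pow_right_injective₀ (by norm_num : (0 : ℝ) < 64) (by norm_num) h).symm

theorem abs_nodeCoeff_le {K j : ℕ} (hj : 2 ≤ j) (hjK : j < K) :
    |nodeCoeff K j| ≤ 2 * (1 / 63) ^ (j - 1) := by
  have e1 : (Finset.range K).erase 0 = insert j (((Finset.range K).erase 0).erase j) := by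
    rw [Finset.insert_erase]; simp; omega
  have e2 : (Finset.range K).erase j = insert 0 (((Finset.range K).erase 0).erase j) := by
    ext i; simp; omega
  have e3 : ((Finset.range K).erase 0).erase j = Finset.Ico 1 j ∪ Finset.Ico (j + 1) K := by
    ext i; simp; omega
  have hd : Disjoint (Finset.Ico 1 j) (Finset.Ico (j + 1) K) := by
    rw [Finset.disjoint_left]; intro i; simp; omega
  have hB : ∀ i : ℕ, 1 ≤ (64 : ℝ) ^ i := fun i => one_le_pow₀ (by norm_num)
  have hne : |(64 : ℝ) ^ 0 - 64 ^ j| ≠ 0 := by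
    rw [abs_ne_zero, sub_ne_zero]
    exact fun h => by
      have := pow_right_injective₀ (by norm_num : (0 : ℝ) < 64) (by norm_num) h
      omega
  rw [nodeCoeff, e2, e1, Finset.erase_insert (by simp), e3, Finset.prod_insert (by simp),
    Finset.prod_insert (by simp), abs_div, abs_mul, abs_mul, abs_sub_comm (64 ^ j) (64 ^ 0),
    mul_div_mul_left _ _ hne, Finset.abs_prod, Finset.abs_prod, ← Finset.prod_div_distrib,
    Finset.prod_union hd, mul_comm]
  refine mul_le_mul ?_ ?_ (Finset.prod_nonneg fun i _ => by positivity) (by norm_num)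
  · rw [Finset.prod_Ico_eq_prod_range]
    have h1 := half_le_prod_one_sub_pow (K - (j + 1))
    have h0 : (0 : ℝ) < (1 / 64 : ℝ) ^ (K - (j + 1)) := by positivity
    calc _ ≤ ∏ t ∈ Finset.range (K - (j + 1)), (1 - (1 / 64 : ℝ) ^ (t + 1))⁻¹ := by
            refine Finset.prod_le_prod (fun i _ => by positivity) fun t _ => ?_
            have ht : (1 / 64 : ℝ) ^ (t + 1) < 1 := pow_lt_one₀ (by norm_num) (by norm_num) (by omega)
            have e : (64 : ℝ) ^ (j + 1 + t) = 64 ^ j * 64 ^ (t + 1) := by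
              rw [← pow_add]; congr 1; omega
            have hc : (1 / 64 : ℝ) ^ (t + 1) = ((64 : ℝ) ^ (t + 1))⁻¹ := by simp
            have hu : (1 : ℝ) < 64 ^ (t + 1) := one_lt_pow₀ (by norm_num) (by omega)
            have hw := hB j
            rw [hc, e, abs_sub_comm, abs_sub_comm (64 ^ j), pow_zero]
            set u := (64 : ℝ) ^ (t + 1)
            set w := (64 : ℝ) ^ j
            rw [abs_of_nonneg (by nlinarith), abs_of_nonneg (by nlinarith), ← one_div,
              div_le_div_iff₀ (by nlinarith) (by rw [sub_pos]; exact inv_lt_one_of_one_lt₀ hu)]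
            have : u * u⁻¹ = 1 := mul_inv_cancel₀ (by positivity)
            have hi : 0 < u⁻¹ := by positivity
            nlinarith
      _ ≤ 2 := by
            rw [Finset.prod_inv_distrib, inv_le_comm₀ (by linarith) (by norm_num)]
            linarith
  · have hcard : (Finset.Ico 1 j).card = j - 1 := by simp
    rw [← hcard]
    refine (Finset.prod_le_prod (fun i _ => by positivity) fun i hi => ?_).trans_eq
      (Finset.prod_const _)
    rw [Finset.mem_Ico] at hi
    have e : (64 : ℝ) ^ j = 64 ^ i * 64 ^ (j - i) := by rw [← pow_add]; congr 1; omega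
    have hu : (64 : ℝ) ≤ 64 ^ (j - i) := le_self_pow₀ (by norm_num) (by omega)
    have hw := hB i
    rw [e, abs_sub_comm, pow_zero]
    set u := (64 : ℝ) ^ (j - i)
    set w := (64 : ℝ) ^ i
    rw [abs_of_nonneg (by nlinarith), abs_of_nonneg (by nlinarith),
      div_le_div_iff₀ (by nlinarith) (by norm_num)]
    nlinarith

theorem sum_abs_nodeCoeff_le (K : ℕ) :
    ∑ j ∈ Finset.Ico 2 K, |nodeCoeff K j| ≤ 1 / 31 := by
  calc _ ≤ ∑ j ∈ Finset.Ico 2 K, 2 * (1 / 63 : ℝ) ^ (j - 1) :=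
        Finset.sum_le_sum fun j hj => by
          rw [Finset.mem_Ico] at hj
          exact abs_nodeCoeff_le hj.1 hj.2
    _ = (2 / 63) * ∑ t ∈ Finset.range (K - 2), (1 / 63 : ℝ) ^ t := by
        rw [Finset.sum_Ico_eq_sum_range, Finset.mul_sum]
        refine Finset.sum_congr rfl fun t _ => ?_
        rw [show 2 + t - 1 = t + 1 by omega, pow_succ]; ring
    _ ≤ (2 / 63) * (1 - 1 / 63)⁻¹ := by
        gcongr
        rw [← tsum_geometric_of_lt_one (by norm_num) (by norm_num)]
        exact (summable_geometric_of_lt_one (by norm_num) (by norm_num)).sum_le_tsum _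
          fun _ _ => by positivity
    _ = 1 / 31 := by norm_num

/-- The mixture, with coefficients `b j`, of the uniform distributions on
`regularMaps L (64 ^ j)`, `j < K`. -/
noncomputable def mixtureWeight (L K : ℕ) (b : ℕ → ℝ) (f : Fin L → Fin L) : ℝ :=
  ∑ j ∈ Finset.range K,
    b j * (if f ∈ regularMaps L (64 ^ j) then ((regularMaps L (64 ^ j)).card : ℝ)⁻¹ else 0)

theorem mixtureWeight_nonneg {L K : ℕ} {b : ℕ → ℝ} (hb : ∀ j, 0 ≤ b j) (f : Fin L → Fin L) :
    0 ≤ mixtureWeight L K b f :=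
  Finset.sum_nonneg fun j _ => mul_nonneg (hb j) (by split_ifs <;> positivity)

theorem sum_mixtureWeight_filter {L K : ℕ} {b : ℕ → ℝ} (P : (Fin L → Fin L) → Prop)
    [DecidablePred P] : ∑ f with P f, mixtureWeight L K b f = ∑ j ∈ Finset.range K,
      b j * ((((regularMaps L (64 ^ j)).filter P).card : ℝ) / (regularMaps L (64 ^ j)).card) := by
  simp only [mixtureWeight]
  rw [Finset.sum_comm]
  refine Finset.sum_congr rfl fun j _ => ?_
  rw [← Finset.mul_sum, ← Finset.sum_filter, Finset.sum_const, nsmul_eq_mul, div_eq_mul_inv]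
  congr 4
  ext f
  simp [and_comm]

/-- Two distributions on the self-maps of a finite set whose restrictions to `k` points agree.
One lives on maps with a small range, the other mostly on injective maps. -/
structure IndistinguishablePair (k L : ℕ) (μ ν : (Fin L → Fin L) → ℝ) : Prop where
  nonneg_left : ∀ f, 0 ≤ μ f
  nonneg_right : ∀ f, 0 ≤ ν f
  sum_left : ∑ f, μ f = 1
  sum_right : ∑ f, ν f = 1
  marginal : ∀ (T : Finset (Fin L)) (g : Fin L → Fin L), T.card ≤ k →
    ∑ f with (∀ s ∈ T, f s = g s), μ f = ∑ f with (∀ s ∈ T, f s = g s), ν f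
  card_image : ∀ f, μ f ≠ 0 → 64 * (Finset.univ.image f).card ≤ L
  injective : 31 / 32 ≤ ∑ f with Function.Injective f, ν f

theorem exists_indistinguishablePair (k : ℕ) :
    ∃ μ ν, IndistinguishablePair k (64 ^ (k + 1)) μ ν := by
  set L := 64 ^ (k + 1) with hL
  set K := k + 2 with hK
  set a := nodeCoeff K with ha
  have hcard : ∀ j ∈ Finset.range K, ((regularMaps L (64 ^ j)).card : ℝ) ≠ 0 := by
    intro j hj
    rw [Finset.mem_range] at hj
    rw [Nat.cast_ne_zero, Finset.card_ne_zero]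
    exact regularMaps_nonempty (by positivity) (pow_dvd_pow 64 (by omega))
  have hsum : ∑ j ∈ Finset.range K, a j = 0 := by
    simpa using sum_nodeCoeff_mul_eval (K := K) (p := 1) (by simp [hK])
  have ha0 : a 0 = 1 := nodeCoeff_zero K
  have hsplit : ∀ h : ℕ → ℝ, ∑ j ∈ Finset.range K, h j = h 0 + h 1 + ∑ j ∈ Finset.Ico 2 K, h j := by
    intro h
    rw [Finset.range_eq_Ico, Finset.sum_eq_sum_Ico_succ_bot (by omega),
      Finset.sum_eq_sum_Ico_succ_bot (by omega), ← add_assoc]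
  have habs := sum_abs_nodeCoeff_le K
  have ha1 : a 1 ≤ 0 := by
    have h1 := hsplit a
    have h2 := (neg_abs_le _).trans' (neg_le_neg (Finset.abs_sum_le_sum_abs a (Finset.Ico 2 K)))
    linarith
  set Z := ∑ j ∈ Finset.range K, max (a j) 0 with hZ
  have hpm : ∀ j, max (a j) 0 - max (-a j) 0 = a j := by
    intro j
    rcases le_total (a j) 0 with h | h
    · rw [max_eq_right h, max_eq_left (by linarith)]; ring
    · rw [max_eq_left h, max_eq_right (by linarith)]; ring
  have hZ' : Z = ∑ j ∈ Finset.range K, max (-a j) 0 := by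
    rw [← sub_eq_zero, hZ, ← Finset.sum_sub_distrib]
    simp only [hpm, hsum]
  have hZ1 : 1 ≤ Z := by
    refine le_trans (le_max_left 1 0) (ha0 ▸ ?_)
    exact Finset.single_le_sum (f := fun j => max (a j) 0) (fun j _ => le_max_right _ _)
      (Finset.mem_range.2 (by omega))
  have hZ2 : Z ≤ 32 / 31 := by
    have : ∑ j ∈ Finset.Ico 2 K, max (a j) 0 ≤ ∑ j ∈ Finset.Ico 2 K, |a j| :=
      Finset.sum_le_sum fun j _ => max_le (le_abs_self _) (abs_nonneg _)
    rw [hZ, hsplit, ha0, max_eq_right ha1, max_eq_left zero_le_one]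
    linarith
  have hZ0 : 0 < Z := by linarith
  have htotal : ∀ b : ℕ → ℝ, ∑ f, mixtureWeight L K b f = ∑ j ∈ Finset.range K, b j := by
    intro b
    have := sum_mixtureWeight_filter (L := L) (K := K) (b := b) (fun _ => True)
    simp only [Finset.filter_true] at this
    rw [this]
    exact Finset.sum_congr rfl fun j hj => by rw [div_self (hcard j hj), mul_one]
  refine ⟨mixtureWeight L K fun j => max (-a j) 0 / Z, mixtureWeight L K fun j => max (a j) 0 / Z,
    mixtureWeight_nonneg fun j => by positivity, mixtureWeight_nonneg fun j => by positivity,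
    ?_, ?_, ?_, ?_, ?_⟩
  · rw [htotal, ← Finset.sum_div, ← hZ', div_self hZ0.ne']
  · rw [htotal, ← Finset.sum_div, ← hZ, div_self hZ0.ne']
  · intro T g hT
    obtain ⟨p, hp, hv⟩ := exists_polynomial_card_regularExtensions T g
    have h := sum_nodeCoeff_mul_eval (K := K) (p := p) (by omega)
    have h1 : ∀ j ∈ Finset.range K,
        ((((regularMaps L (64 ^ j)).filter fun f => ∀ s ∈ T, f s = g s).card : ℝ) /
          (regularMaps L (64 ^ j)).card) = p.eval ((64 : ℝ) ^ j) := by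
      intro j hj
      rw [div_eq_iff (hcard j hj)]
      simpa [regularExtensions] using hv (64 ^ j)
    rw [sum_mixtureWeight_filter, sum_mixtureWeight_filter,
      Finset.sum_congr rfl fun j hj => by rw [h1 j hj],
      Finset.sum_congr (f := fun j => max (a j) 0 / Z * _) rfl fun j hj => by rw [h1 j hj],
      eq_comm, ← sub_eq_zero, ← Finset.sum_sub_distrib]
    have h2 : ∀ j, max (a j) 0 / Z * p.eval ((64 : ℝ) ^ j) -
        max (-a j) 0 / Z * p.eval ((64 : ℝ) ^ j) = a j * p.eval ((64 : ℝ) ^ j) / Z := by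
      intro j
      nth_rewrite 3 [← hpm j]
      ring
    simp only [h2]
    rw [← Finset.sum_div, h, zero_div]
  · intro f hf
    obtain ⟨j, hj, hne⟩ := Finset.exists_ne_zero_of_sum_ne_zero hf
    have hj0 : j ≠ 0 := by
      rintro rfl
      simp [ha0] at hne
    have hmem : f ∈ regularMaps L (64 ^ j) := by
      by_contra h
      simp [h] at hne
    refine le_of_le_of_eq ?_ (card_image_mul_of_mem_regularMaps hmem)
    rw [mul_comm]
    exact Nat.mul_le_mul_left _ (Nat.le_self_pow hj0 64)
  · rw [sum_mixtureWeight_filter]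
    refine le_trans ?_ (Finset.single_le_sum (fun j _ => by positivity)
      (Finset.mem_range.2 (by omega : 0 < K)))
    have : ((regularMaps L (64 ^ 0)).filter Function.Injective) = regularMaps L (64 ^ 0) :=
      Finset.filter_true_of_mem fun f hf => injective_of_mem_regularMaps_one hf
    rw [this, div_self (hcard 0 (Finset.mem_range.2 (by omega))), ha0, max_eq_left zero_le_one,
      mul_one, le_div_iff₀ hZ0]
    linarith

/-- The product of the distribution `w` over `D` independent groups. -/
noncomputable def productWeight {D L : ℕ} (w : (Fin L → Fin L) → ℝ) (F : Fin D → Fin L → Fin L) :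
    ℝ :=
  ∏ i, w (F i)

theorem sum_productWeight {D L : ℕ} {w : (Fin L → Fin L) → ℝ} (hw : ∑ f, w f = 1) :
    ∑ F : Fin D → Fin L → Fin L, productWeight w F = 1 := by
  have := Finset.prod_univ_sum (fun _ : Fin D => (Finset.univ : Finset (Fin L → Fin L)))
    fun _ f => w f
  rw [Fintype.piFinset_univ] at this
  simp only [productWeight]
  rw [← this, hw, Finset.prod_const_one]

theorem productWeight_nonneg {D L : ℕ} {w : (Fin L → Fin L) → ℝ} (hw : ∀ f, 0 ≤ w f)
    (F : Fin D → Fin L → Fin L) : 0 ≤ productWeight w F :=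
  Finset.prod_nonneg fun _ _ => hw _

theorem sum_productWeight_mul_comp {D L : ℕ} (w : (Fin L → Fin L) → ℝ)
    (r : Fin D → (Fin L → Fin L) → (Fin L → Fin L)) (Ψ : (Fin D → Fin L → Fin L) → ℝ) :
    ∑ F : Fin D → Fin L → Fin L, productWeight w F * Ψ (fun i => r i (F i)) =
      ∑ G : Fin D → Fin L → Fin L, (∏ i, ∑ f with r i f = G i, w f) * Ψ G := by
  rw [← Finset.sum_fiberwise Finset.univ
    (fun (F : Fin D → Fin L → Fin L) => (fun i => r i (F i) : Fin D → Fin L → Fin L))]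
  refine Finset.sum_congr rfl fun G _ => ?_
  rw [Finset.prod_univ_sum, Finset.sum_mul]
  refine Finset.sum_congr ?_ fun F hF => ?_
  · ext F
    simp [funext_iff]
  · rw [Fintype.mem_piFinset] at hF
    rw [productWeight]
    congr 2
    funext i
    exact (Finset.mem_filter.1 (hF i)).2

/-- Functions of at most `k` values in each group have equal expectations. -/
theorem IndistinguishablePair.sum_productWeight_mul_eq {k D L : ℕ} {μ ν : (Fin L → Fin L) → ℝ}
    (h : IndistinguishablePair k L μ ν) (T : Fin D → Finset (Fin L)) (hT : ∀ i, (T i).card ≤ k)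
    (Φ : (Fin D → Fin L → Fin L) → ℝ)
    (hΦ : ∀ F G : Fin D → Fin L → Fin L, (∀ i, ∀ s ∈ T i, F i s = G i s) → Φ F = Φ G) :
    ∑ F, productWeight μ F * Φ F = ∑ F, productWeight ν F * Φ F := by
  let r : Fin D → (Fin L → Fin L) → (Fin L → Fin L) := fun i f s => if s ∈ T i then f s else s
  have hr : ∀ F, Φ F = Φ fun i => r i (F i) := by
    intro F
    refine hΦ _ _ fun i s hs => ?_
    simp [r, hs]
  have hm : ∀ i (g : Fin L → Fin L), ∑ f with r i f = g, μ f = ∑ f with r i f = g, ν f := by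
    intro i g
    by_cases hg : ∀ s, s ∉ T i → g s = s
    · have e : ∀ f, r i f = g ↔ ∀ s ∈ T i, f s = g s := by
        intro f
        constructor
        · rintro rfl s hs
          simp [r, hs]
        · intro hf
          funext s
          by_cases hs : s ∈ T i
          · simp [r, hs, hf s hs]
          · simp [r, hs, hg s hs]
      simp only [e]
      exact h.marginal (T i) g (hT i)
    · push Not at hg
      obtain ⟨s, hs, hne⟩ := hg
      have e : ∀ f, ¬ r i f = g := by
        rintro f rfl
        simp [r, hs] at hne
      simp [e]
  calc _ = ∑ F, productWeight μ F * Φ fun i => r i (F i) :=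
        Finset.sum_congr rfl fun F _ => by rw [← hr]
    _ = ∑ F, productWeight ν F * Φ fun i => r i (F i) := by
        rw [sum_productWeight_mul_comp, sum_productWeight_mul_comp]
        simp only [hm]
    _ = _ := Finset.sum_congr rfl fun F _ => by rw [← hr]

/-- Markov's inequality for the number of groups that are not injective. -/
theorem IndistinguishablePair.sum_productWeight_filter_le {k D L : ℕ} {μ ν : (Fin L → Fin L) → ℝ}
    (h : IndistinguishablePair k L μ ν) :
    ∑ F : Fin D → Fin L → Fin L with
        2 * (Finset.univ.filter fun i => Function.Injective (F i)).card < D, productWeight ν F ≤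
      1 / 16 := by
  rcases Nat.eq_zero_or_pos D with rfl | hD
  · simp
  have hcompl : ∑ f with ¬ Function.Injective f, ν f ≤ 1 / 32 := by
    have := Finset.sum_filter_add_sum_filter_not Finset.univ
      (fun f : Fin L → Fin L => Function.Injective f) ν
    rw [h.sum_right] at this
    linarith [h.injective]
  have hone : ∀ i : Fin D, ∑ F : Fin D → Fin L → Fin L,
      productWeight ν F * (if Function.Injective (F i) then 0 else 1) ≤ 1 / 32 := by
    intro i
    have h1 : ∀ F : Fin D → Fin L → Fin L,
        productWeight ν F * (if Function.Injective (F i) then 0 else 1) =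
        ∏ i', ν (F i') * (if i' = i then (if Function.Injective (F i') then 0 else 1) else 1) := by
      intro F
      rw [Finset.prod_mul_distrib, Finset.prod_ite_eq' Finset.univ i]
      simp [productWeight]
    simp only [h1]
    have h2 := Finset.prod_univ_sum (fun _ : Fin D => (Finset.univ : Finset (Fin L → Fin L)))
      fun i' f => ν f * (if i' = i then (if Function.Injective f then 0 else 1) else 1)
    rw [Fintype.piFinset_univ] at h2
    rw [← h2, Finset.prod_eq_single i]
    · simp only [if_true]
      refine le_trans (le_of_eq ?_) hcompl
      rw [Finset.sum_filter]
      exact Finset.sum_congr rfl fun f _ => by split_ifs <;> simp_all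
    · intro i' _ hi'
      simp [hi', h.sum_right]
    · simp
  have hDr : (0 : ℝ) < D := by exact_mod_cast hD
  have hsum : ∑ F : Fin D → Fin L → Fin L, productWeight ν F *
      ((Finset.univ.filter fun i => ¬ Function.Injective (F i)).card : ℝ) ≤ D / 32 := by
    have : ∀ F : Fin D → Fin L → Fin L, productWeight ν F *
        ((Finset.univ.filter fun i => ¬ Function.Injective (F i)).card : ℝ) =
        ∑ i, productWeight ν F * (if Function.Injective (F i) then 0 else 1) := by
      intro F
      rw [← Finset.mul_sum, Finset.card_filter]
      push_cast
      simp only [ite_not]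
    simp only [this]
    rw [Finset.sum_comm]
    refine (Finset.sum_le_sum fun i _ => hone i).trans_eq ?_
    simp; ring
  have hle : (∑ F : Fin D → Fin L → Fin L with
        2 * (Finset.univ.filter fun i => Function.Injective (F i)).card < D, productWeight ν F) *
          (D / 2) ≤ D / 32 := by
    refine le_trans ?_ hsum
    rw [Finset.sum_mul]
    refine le_trans (Finset.sum_le_sum fun F hF => ?_) (Finset.sum_le_sum_of_subset_of_nonneg
      (Finset.filter_subset _ _) fun F _ _ =>
        mul_nonneg (productWeight_nonneg h.nonneg_right F) (Nat.cast_nonneg _))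
    refine mul_le_mul_of_nonneg_left ?_ (productWeight_nonneg h.nonneg_right F)
    have h1 := Finset.card_filter_add_card_filter_not (s := (Finset.univ : Finset (Fin D)))
      (fun i => Function.Injective (F i))
    rw [Finset.card_univ, Fintype.card_fin] at h1
    have h2 := (Finset.mem_filter.1 hF).2
    rw [div_le_iff₀ two_pos]
    exact_mod_cast (by omega)
  have : (∑ F : Fin D → Fin L → Fin L with
        2 * (Finset.univ.filter fun i => Function.Injective (F i)).card < D, productWeight ν F) *
          (D / 2) ≤ 1 / 16 * (D / 2) := by linarith
  exact le_of_mul_le_mul_right this (by positivity)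

/-- The point of the moment curve in `ℝⁿ` with parameter `t`. -/
def momentPoint (n t : ℕ) (i : Fin n) : ℝ := (t : ℝ) ^ ((i : ℕ) + 1)

/-- The parameter of the point with index `p` when `F` maps slots to blocks of length `L`. -/
def curveParam {D L : ℕ} (F : Fin D → Fin L → Fin L) (p : Fin (D * L)) : ℕ :=
  (p.divNat * L + F p.divNat p.modNat) * L + p.modNat

/-- The points on the moment curve determined by `F`. -/
def curvePoints (n : ℕ) {D L : ℕ} (F : Fin D → Fin L → Fin L) (p : Fin (D * L)) : Fin n → ℝ :=
  momentPoint n (curveParam F p)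

open Classical in
/-- The labelling of the moment curve that alternates between consecutive blocks of length `L`. -/
noncomputable def alternatingLabel (n L : ℕ) (y : Fin n → ℝ) : ℤˣ :=
  if ∃ t : ℕ, y = momentPoint n t ∧ Even (t / L) then 1 else -1

theorem card_divNat_eq {D L : ℕ} (i : Fin D) :
    (Finset.univ.filter fun p : Fin (D * L) => p.divNat = i).card = L := by
  have : (({i} : Finset (Fin D)) ×ˢ (Finset.univ : Finset (Fin L))).card = L := by simp
  refine Eq.trans ?_ this
  refine Finset.card_equiv finProdFinEquiv.symm fun p => ?_
  simp [eq_comm]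

theorem card_exists_group_le (D L k m : ℕ) :
    (Finset.univ.filter fun j : Fin m → Fin (D * L) =>
      ∃ i, k < (Finset.univ.filter fun a => (j a).divNat = i).card).card * D ^ k ≤
      m ^ (k + 1) * (D * L) ^ m := by
  have hsub : (Finset.univ.filter fun j : Fin m → Fin (D * L) =>
      ∃ i, k < (Finset.univ.filter fun a => (j a).divNat = i).card) ⊆
      Finset.univ.biUnion fun i : Fin D =>
        (Finset.powersetCard (k + 1) (Finset.univ : Finset (Fin m))).biUnion fun S =>
          Fintype.piFinset fun a => if a ∈ S then
            Finset.univ.filter fun p : Fin (D * L) => p.divNat = i else Finset.univ := by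
    intro j hj
    obtain ⟨i, hi⟩ := (Finset.mem_filter.1 hj).2
    obtain ⟨S, hS, hcard⟩ := Finset.exists_subset_card_eq (Nat.succ_le_of_lt hi)
    simp only [Finset.mem_biUnion, Finset.mem_univ, true_and, Finset.mem_powersetCard,
      Fintype.mem_piFinset]
    refine ⟨i, S, ⟨Finset.subset_univ _, hcard⟩, fun a => ?_⟩
    split_ifs with ha
    · simpa using hS ha
    · simp
  have hbound : (Finset.univ.filter fun j : Fin m → Fin (D * L) =>
      ∃ i, k < (Finset.univ.filter fun a => (j a).divNat = i).card).card ≤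
      D * (m.choose (k + 1) * (L ^ (k + 1) * (D * L) ^ (m - (k + 1)))) := by
    refine (Finset.card_le_card hsub).trans ?_
    refine (Finset.card_biUnion_le_card_mul _ _ _ fun i _ => ?_).trans_eq
      (by rw [Finset.card_univ, Fintype.card_fin])
    refine (Finset.card_biUnion_le_card_mul _ _ _ fun S hS => le_of_eq ?_).trans_eq
      (by rw [Finset.card_powersetCard, Finset.card_univ, Fintype.card_fin])
    have hS' := (Finset.mem_powersetCard.1 hS).2
    rw [Fintype.card_piFinset]
    have : ∀ a, (if a ∈ S then Finset.univ.filter fun p : Fin (D * L) => p.divNat = i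
        else Finset.univ).card = if a ∈ S then L else D * L := by
      intro a
      split_ifs
      · exact card_divNat_eq i
      · simp
    simp only [this]
    rw [Finset.prod_ite, Finset.prod_const, Finset.prod_const, Finset.filter_mem_eq_inter,
      Finset.univ_inter, hS', Finset.filter_not, Finset.filter_mem_eq_inter, Finset.univ_inter,
      Finset.card_sdiff_of_subset (Finset.subset_univ _), hS', Finset.card_univ, Fintype.card_fin]
  refine (Nat.mul_le_mul_right _ hbound).trans ?_
  rcases lt_or_ge m (k + 1) with hm | hm
  · simp [Nat.choose_eq_zero_of_lt hm]
  · calc _ = m.choose (k + 1) * ((D * L) ^ (k + 1) * (D * L) ^ (m - (k + 1))) := by ring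
      _ = m.choose (k + 1) * (D * L) ^ m := by rw [← pow_add, Nat.add_sub_cancel' hm]
      _ ≤ _ := Nat.mul_le_mul_right _ (Nat.choose_le_pow _ _)

theorem IndistinguishablePair.acceptProb_sub_le {k D L n m : ℕ} {μ ν : (Fin L → Fin L) → ℝ}
    (h : IndistinguishablePair k L μ ν) (hD : 0 < D) (hL : 0 < L) (A : DecisionRule n m)
    (ℓ : (Fin n → ℝ) → ℤˣ) :
    ∑ F : Fin D → Fin L → Fin L, productWeight μ F * acceptProb A (curvePoints n F) ℓ -
      ∑ F : Fin D → Fin L → Fin L, productWeight ν F * acceptProb A (curvePoints n F) ℓ ≤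
      (m : ℝ) ^ (k + 1) / (D : ℝ) ^ k := by
  set view : (Fin D → Fin L → Fin L) → (Fin m → Fin (D * L)) → ℝ := fun F j =>
    (A (fun a => (curvePoints n F (j a), ℓ (curvePoints n F (j a)))) : ℝ) with hview
  have hN : (0 : ℝ) < ((D * L : ℕ) : ℝ) ^ m := by positivity
  have hswap : ∀ w : (Fin L → Fin L) → ℝ,
      ∑ F : Fin D → Fin L → Fin L, productWeight w F * acceptProb A (curvePoints n F) ℓ =
      (∑ j, ∑ F, productWeight w F * view F j) / ((D * L : ℕ) : ℝ) ^ m := by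
    intro w
    rw [Finset.sum_comm, Finset.sum_div]
    refine Finset.sum_congr rfl fun F _ => ?_
    rw [acceptProb, ← Finset.mul_sum, mul_div_assoc]
  have hterm : ∀ j : Fin m → Fin (D * L),
      ∑ F, productWeight μ F * view F j - ∑ F, productWeight ν F * view F j ≤
      if ∃ i, k < (Finset.univ.filter fun a => (j a).divNat = i).card then 1 else 0 := by
    intro j
    split_ifs with hj
    · have h1 : ∑ F, productWeight μ F * view F j ≤ 1 := by
        rw [← sum_productWeight (D := D) h.sum_left]
        exact Finset.sum_le_sum fun F _ =>
          mul_le_of_le_one_right (productWeight_nonneg h.nonneg_left F) (A _).2.2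
      have h2 : 0 ≤ ∑ F, productWeight ν F * view F j := Finset.sum_nonneg fun F _ =>
        mul_nonneg (productWeight_nonneg h.nonneg_right F) (A _).2.1
      linarith
    · push Not at hj
      refine (sub_eq_zero.2 ?_).le
      refine h.sum_productWeight_mul_eq
        (fun i => (Finset.univ.filter fun a => (j a).divNat = i).image fun a => (j a).modNat)
        (fun i => Finset.card_image_le.trans (hj i)) (fun F => view F j) ?_
      intro F G hFG
      have : ∀ a, curvePoints n F (j a) = curvePoints n G (j a) := by
        intro a
        rw [curvePoints, curvePoints, curveParam, curveParam, hFG (j a).divNat (j a).modNat]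
        exact Finset.mem_image.2 ⟨a, by simp, rfl⟩
      simp only [hview, this]
  rw [hswap, hswap, ← sub_div, ← Finset.sum_sub_distrib, div_le_div_iff₀ hN (by positivity)]
  have hsum := Finset.sum_le_sum fun j (_ : j ∈ Finset.univ) => hterm j
  rw [← Finset.sum_filter, Finset.sum_const, nsmul_eq_mul, mul_one] at hsum
  refine (mul_le_mul_of_nonneg_right hsum (by positivity)).trans ?_
  exact_mod_cast card_exists_group_le D L k m

theorem momentPoint_injective {n : ℕ} (hn : 0 < n) : Function.Injective (momentPoint n) := by
  intro s t h
  have := congrFun h ⟨0, hn⟩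
  simpa [momentPoint] using this

theorem curveParam_mod {D L : ℕ} (F : Fin D → Fin L → Fin L) (p : Fin (D * L)) :
    curveParam F p % L = p.modNat := by
  rw [curveParam, Nat.mul_add_mod_self_right, Nat.mod_eq_of_lt p.modNat.2]

theorem curveParam_div {D L : ℕ} (F : Fin D → Fin L → Fin L) (p : Fin (D * L)) :
    curveParam F p / L = p.divNat * L + F p.divNat p.modNat := by
  have := p.modNat.2
  rw [curveParam, mul_comm, Nat.mul_add_div (by omega), Nat.div_eq_of_lt this, add_zero]

theorem curveParam_div_div {D L : ℕ} (F : Fin D → Fin L → Fin L) (p : Fin (D * L)) :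
    curveParam F p / L / L = p.divNat := by
  have := (F p.divNat p.modNat).2
  rw [curveParam_div, mul_comm, Nat.mul_add_div (by omega), Nat.div_eq_of_lt this, add_zero]

theorem curveParam_injective {D L : ℕ} (F : Fin D → Fin L → Fin L) :
    Function.Injective (curveParam F) := by
  intro p q h
  refine finProdFinEquiv.symm.injective (Prod.ext (Fin.ext ?_) (Fin.ext ?_))
  · have := congrArg (fun t => t / L / L) h
    simp only [curveParam_div_div] at this
    exact this
  · have := congrArg (fun t => t % L) h
    simp only [curveParam_mod] at this
    exact this

theorem curvePoints_injective {n D L : ℕ} (hn : 0 < n) (F : Fin D → Fin L → Fin L) :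
    Function.Injective (curvePoints n F) :=
  (momentPoint_injective hn).comp (curveParam_injective F)

theorem alternatingLabel_momentPoint {n : ℕ} (hn : 0 < n) (L t : ℕ) :
    alternatingLabel n L (momentPoint n t) = if Even (t / L) then 1 else -1 := by
  unfold alternatingLabel
  congr 1
  refine propext ⟨?_, fun h => ⟨t, rfl, h⟩⟩
  rintro ⟨s, hs, he⟩
  rwa [momentPoint_injective hn hs]

theorem exists_halfspace_momentPoint_eq {n : ℕ} (p : Polynomial ℝ) (hp : p.natDegree ≤ n) :
    ∃ w₀ w, ∀ t : ℕ, halfspace (n := n) w₀ w (momentPoint n t) =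
      if 0 ≤ p.eval (t : ℝ) then 1 else -1 := by
  refine ⟨p.coeff 0, fun i => p.coeff (i + 1), fun t => ?_⟩
  rw [halfspace, Polynomial.eval_eq_sum_range' (Nat.lt_succ_of_le hp), Finset.sum_range,
    Fin.sum_univ_succ]
  simp [momentPoint]
  congr

theorem exists_polynomial_halfspace_eq {n : ℕ} (w₀ : ℝ) (w : Fin n → ℝ) :
    ∃ p : Polynomial ℝ, p.natDegree ≤ n ∧ ∀ t : ℕ, halfspace w₀ w (momentPoint n t) =
      if 0 ≤ p.eval (t : ℝ) then 1 else -1 := by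
  refine ⟨Polynomial.C w₀ + ∑ i : Fin n, Polynomial.C (w i) * Polynomial.X ^ ((i : ℕ) + 1),
    ?_, fun t => ?_⟩
  · refine (Polynomial.natDegree_add_le _ _).trans (max_le (by simp) ?_)
    refine Polynomial.natDegree_sum_le_of_forall_le _ _ fun i _ => ?_
    exact (Polynomial.natDegree_C_mul_X_pow_le _ _).trans i.2
  · simp [halfspace, momentPoint, Polynomial.eval_finsetSum]
    congr

/-- A sign pattern on `Q.card` blocks of length `L` is that of a polynomial of degree at most
`Q.card`. -/
theorem exists_polynomial_sign_eq {L : ℕ} (hL0 : 0 < L) (h : ℕ → ℤˣ) (Q : Finset ℕ) :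
    ∃ (p : Polynomial ℝ) (s : ℤˣ), p.natDegree ≤ Q.card ∧
      (∀ t : ℕ, t / L ∈ Q → 0 < ((h (t / L) : ℤ) : ℝ) * p.eval (t : ℝ)) ∧
      ∀ t : ℝ, (∀ u : ℕ, u / L ∈ Q → (u : ℝ) ≤ t) → 0 < ((s : ℤ) : ℝ) * p.eval t := by
  induction Q using Finset.induction_on_max with
  | empty => exact ⟨1, 1, by simp, by simp, by simp⟩
  | insert q Q hq ih =>
    obtain ⟨p, s, hdeg, hsign, hlast⟩ := ih
    have hqQ : q ∉ Q := fun h => lt_irrefl _ (hq q h)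
    have hlt : ∀ u t : ℕ, u / L ∈ Q → t / L = q → u < t := by
      intro u t hu ht
      by_contra hle
      have := Nat.div_le_div_right (c := L) (not_lt.1 hle)
      have := hq _ hu
      omega
    rw [Finset.card_insert_of_notMem hqQ]
    by_cases hs : s = h q
    · refine ⟨p, s, by omega, ?_, fun t ht => hlast t fun u hu => ht u (Finset.mem_insert_of_mem hu)⟩
      intro t ht
      rcases Finset.mem_insert.1 ht with ht | ht
      · rw [ht, ← hs]
        exact hlast t fun u hu => by exact_mod_cast (hlt u t hu ht).le
      · exact hsign t ht
    · have hneg : h q = -s := by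
        rcases Int.units_eq_one_or s with rfl | rfl <;>
          rcases Int.units_eq_one_or (h q) with h' | h' <;> simp_all
      set τ : ℝ := (q * L : ℕ) - 1 / 2 with hτ
      have hL : ∀ t : ℕ, t / L = q → τ < t := by
        intro t ht
        have : ((q * L : ℕ) : ℝ) ≤ t := by
          rw [← ht]; exact_mod_cast Nat.div_mul_le_self t L
        linarith
      have hR : ∀ u : ℕ, u / L ∈ Q → (u : ℝ) < τ := by
        intro u hu
        have h1 : u + 1 ≤ q * L := (Nat.div_lt_iff_lt_mul hL0).1 (hq _ hu)
        have h2 : (u : ℝ) + 1 ≤ (q * L : ℕ) := by exact_mod_cast h1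
        linarith
      refine ⟨(Polynomial.C τ - Polynomial.X) * p, -s, ?_, ?_, ?_⟩
      · refine Polynomial.natDegree_mul_le.trans ?_
        have : (Polynomial.C τ - Polynomial.X).natDegree ≤ 1 :=
          (Polynomial.natDegree_sub_le _ _).trans (max_le (by simp) Polynomial.natDegree_X_le)
        omega
      · intro t ht
        simp only [Polynomial.eval_mul, Polynomial.eval_sub, Polynomial.eval_C, Polynomial.eval_X]
        rcases Finset.mem_insert.1 ht with ht | ht
        · rw [ht, hneg]
          have h1 := hlast t fun u hu => by exact_mod_cast (hlt u t hu ht).le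
          have h2 := hL t ht
          push_cast
          nlinarith
        · have h1 := hsign t ht
          have h2 := hR t ht
          nlinarith
      · intro t ht
        simp only [Polynomial.eval_mul, Polynomial.eval_sub, Polynomial.eval_C, Polynomial.eval_X]
        have h1 := hlast t fun u hu => ht u (Finset.mem_insert_of_mem hu)
        have h2 : τ < t := by
          have := ht (q * L) (by rw [Nat.mul_div_cancel _ hL0]; exact Finset.mem_insert_self _ _)
          linarith
        push_cast
        nlinarith

theorem realizable_curvePoints {n D L : ℕ} (hn : 0 < n) (hL : 0 < L) (hDL : D * L ≤ 64 * n)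
    {F : Fin D → Fin L → Fin L} (hF : ∀ i, 64 * (Finset.univ.image (F i)).card ≤ L) :
    Realizable (curvePoints n F) (alternatingLabel n L) := by
  set Q : Finset ℕ := Finset.univ.biUnion fun i : Fin D =>
    (Finset.univ.image (F i)).image fun c : Fin L => (i : ℕ) * L + c with hQ
  have hcard : Q.card ≤ n := by
    have h1 : Q.card ≤ ∑ i : Fin D, (Finset.univ.image (F i)).card :=
      Finset.card_biUnion_le.trans (Finset.sum_le_sum fun i _ => Finset.card_image_le)
    have h2 : 64 * ∑ i : Fin D, (Finset.univ.image (F i)).card ≤ D * L := by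
      rw [Finset.mul_sum]
      exact (Finset.sum_le_sum fun i _ => hF i).trans_eq (by simp)
    omega
  obtain ⟨p, -, hp, hsign, -⟩ := exists_polynomial_sign_eq hL
    (fun q => if Even q then 1 else -1) Q
  obtain ⟨w₀, w, hw⟩ := exists_halfspace_momentPoint_eq p (hp.trans hcard)
  refine ⟨w₀, w, fun x => ?_⟩
  have hx := hsign (curveParam F x) (by
    rw [curveParam_div, hQ]
    simp only [Finset.mem_biUnion, Finset.mem_univ, true_and, Finset.mem_image]
    exact ⟨x.divNat, _, ⟨_, rfl⟩, rfl⟩)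
  rw [curvePoints, hw, alternatingLabel_momentPoint hn]
  split_ifs with h1 h2 h2
  · rfl
  · simp [h2] at hx; linarith
  · simp [h2] at hx; linarith
  · rfl

/-- If pairs of points lie in consecutive blocks of length `L`, the first one even, then the sign
of a polynomial of degree at most `n` cannot match the alternating labels on more than `n` pairs. -/
theorem card_le_add_card_sign_ne {ι : Type*} {n N L : ℕ} (S : Finset ι)
    (a b : ι → Fin N) (t : Fin N → ℕ) (β : ι → ℕ) (hβ : Set.InjOn β S)
    (ha : ∀ x ∈ S, t (a x) / L = 2 * β x) (hb : ∀ x ∈ S, t (b x) / L = 2 * β x + 1)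
    (p : Polynomial ℝ) (hp : p.natDegree ≤ n) :
    S.card ≤ n + (Finset.univ.filter fun q : Fin N =>
      (if 0 ≤ p.eval (t q : ℝ) then 1 else -1 : ℤˣ) ≠ if Even (t q / L) then 1 else -1).card := by
  classical
  set W := Finset.univ.filter fun q : Fin N =>
      (if 0 ≤ p.eval (t q : ℝ) then 1 else -1 : ℤˣ) ≠ if Even (t q / L) then 1 else -1 with hW
  have hWa : ∀ x ∈ S, a x ∉ W → 0 ≤ p.eval (t (a x) : ℝ) := by
    intro x hx h
    rw [hW, Finset.mem_filter, ha x hx] at h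
    by_contra h0
    simp [h0] at h
  have hWb : ∀ x ∈ S, b x ∉ W → p.eval (t (b x) : ℝ) < 0 := by
    intro x hx h
    rw [hW, Finset.mem_filter, hb x hx] at h
    by_contra h0
    simp [not_lt.1 h0] at h
  have hlt : ∀ x ∈ S, t (a x) < t (b x) := by
    intro x hx
    by_contra hle
    have := Nat.div_le_div_right (c := L) (not_lt.1 hle)
    rw [ha x hx, hb x hx] at this
    omega
  have hroot : ∀ x ∈ S.filter fun x => a x ∉ W ∧ b x ∉ W,
      ∃ r ∈ p.roots.toFinset, (t (a x) : ℝ) ≤ r ∧ r ≤ t (b x) := by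
    intro x hx
    obtain ⟨hx, h1, h2⟩ := Finset.mem_filter.1 hx
    have h3 : (t (a x) : ℝ) ≤ t (b x) := by exact_mod_cast (hlt x hx).le
    obtain ⟨r, hr, hr0⟩ := intermediate_value_Icc' h3 p.continuous.continuousOn
      ⟨(hWb x hx h2).le, hWa x hx h1⟩
    refine ⟨r, ?_, hr.1, hr.2⟩
    rw [Multiset.mem_toFinset, Polynomial.mem_roots']
    refine ⟨?_, hr0⟩
    intro h0
    simpa [h0] using hWb x hx h2
  choose! r hr hr1 hr2 using hroot
  have hagree : (S.filter fun x => a x ∉ W ∧ b x ∉ W).card ≤ n := by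
    refine le_trans (Finset.card_le_card_of_injOn r hr ?_)
      ((Multiset.toFinset_card_le _).trans ((Polynomial.card_roots' p).trans hp))
    have hne : ∀ x ∈ S.filter fun x => a x ∉ W ∧ b x ∉ W,
        ∀ y ∈ S.filter fun x => a x ∉ W ∧ b x ∉ W, β x < β y → r x < r y := by
      intro x hx y hy hxy
      refine (hr2 x hx).trans_lt (lt_of_lt_of_le ?_ (hr1 y hy))
      rw [Nat.cast_lt]
      by_contra hle
      have := Nat.div_le_div_right (c := L) (not_lt.1 hle)
      rw [ha y (Finset.mem_filter.1 hy).1, hb x (Finset.mem_filter.1 hx).1] at this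
      omega
    intro x hx y hy hxy
    rcases lt_trichotomy (β x) (β y) with h | h | h
    · exact absurd hxy (hne x hx y hy h).ne
    · exact hβ (Finset.mem_filter.1 hx).1 (Finset.mem_filter.1 hy).1 h
    · exact absurd hxy (hne y hy x hx h).ne'
  have hwrong : (S.filter fun x => a x ∈ W).card + (S.filter fun x => b x ∈ W).card ≤ W.card := by
    have h1 : Set.InjOn a (S.filter fun x => a x ∈ W : Finset ι) := by
      intro x hx y hy hxy
      have hx := (Finset.mem_filter.1 hx).1
      have hy := (Finset.mem_filter.1 hy).1
      refine hβ hx hy ?_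
      have := ha x hx
      rw [hxy, ha y hy] at this
      omega
    have h2 : Set.InjOn b (S.filter fun x => b x ∈ W : Finset ι) := by
      intro x hx y hy hxy
      have hx := (Finset.mem_filter.1 hx).1
      have hy := (Finset.mem_filter.1 hy).1
      refine hβ hx hy ?_
      have := hb x hx
      rw [hxy, hb y hy] at this
      omega
    rw [← Finset.card_image_of_injOn h1, ← Finset.card_image_of_injOn h2,
      ← Finset.card_union_of_disjoint]
    · refine Finset.card_le_card (Finset.union_subset ?_ ?_) <;>
      · intro q hq
        obtain ⟨x, hx, rfl⟩ := Finset.mem_image.1 hq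
        exact (Finset.mem_filter.1 hx).2
    · rw [Finset.disjoint_left]
      intro q hq hq'
      obtain ⟨x, hx, rfl⟩ := Finset.mem_image.1 hq
      obtain ⟨y, hy, hxy⟩ := Finset.mem_image.1 hq'
      have := hb y (Finset.mem_filter.1 hy).1
      rw [hxy, ha x (Finset.mem_filter.1 hx).1] at this
      omega
  have hcover : S ⊆ (S.filter fun x => a x ∉ W ∧ b x ∉ W) ∪
      ((S.filter fun x => a x ∈ W) ∪ S.filter fun x => b x ∈ W) := by
    intro x hx
    simp only [Finset.mem_union, Finset.mem_filter, hx, true_and]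
    tauto
  have h1 := Finset.card_le_card hcover
  have h2 := Finset.card_union_le (S.filter fun x => a x ∉ W ∧ b x ∉ W)
    ((S.filter fun x => a x ∈ W) ∪ S.filter fun x => b x ∈ W)
  have h3 := Finset.card_union_le (S.filter fun x => a x ∈ W) (S.filter fun x => b x ∈ W)
  omega

theorem farFromRealizable_curvePoints {n D M : ℕ} (hn : 0 < n)
    (hDL : 8 * n ≤ D * (2 * M)) {F : Fin D → Fin (2 * M) → Fin (2 * M)}
    (hF : D ≤ 2 * (Finset.univ.filter fun i => Function.Injective (F i)).card) :
    FarFromRealizable (1 / 8) (curvePoints n F) (alternatingLabel n (2 * M)) := by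
  rintro ℓ' ⟨w₀, w, hw⟩
  obtain ⟨p, hp, hsign⟩ := exists_polynomial_halfspace_eq w₀ w
  set I := Finset.univ.filter fun i => Function.Injective (F i) with hI
  have hsurj : ∀ (i : Fin D) (c : Fin (2 * M)), ∃ s, i ∈ I → F i s = c := by
    intro i c
    by_cases hi : i ∈ I
    · obtain ⟨s, hs⟩ := Finite.surjective_of_injective (Finset.mem_filter.1 hi).2 c
      exact ⟨s, fun _ => hs⟩
    · exact ⟨c, fun h => absurd h hi⟩
  choose G hG using hsurj
  have hblock : ∀ i ∈ I, ∀ c,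
      curveParam F (finProdFinEquiv (i, G i c)) / (2 * M) = i * (2 * M) + c := by
    intro i hi c
    have h1 : (finProdFinEquiv (i, G i c)).divNat = i :=
      congrArg Prod.fst (finProdFinEquiv.symm_apply_apply (i, G i c))
    have h2 : (finProdFinEquiv (i, G i c)).modNat = G i c :=
      congrArg Prod.snd (finProdFinEquiv.symm_apply_apply (i, G i c))
    rw [curveParam_div, h1, h2, hG i c hi]
  have key := card_le_add_card_sign_ne (n := n) (L := 2 * M)
    (I ×ˢ (Finset.univ : Finset (Fin M)))
    (fun x => finProdFinEquiv (x.1, G x.1 ⟨2 * x.2, by omega⟩))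
    (fun x => finProdFinEquiv (x.1, G x.1 ⟨2 * x.2 + 1, by omega⟩))
    (curveParam F) (fun x => finProdFinEquiv x)
    ((Fin.val_injective.comp finProdFinEquiv.injective).injOn)
    (fun x hx => by
      rw [hblock x.1 (Finset.mem_product.1 hx).1]
      simp only [finProdFinEquiv_apply_val]; ring)
    (fun x hx => by
      rw [hblock x.1 (Finset.mem_product.1 hx).1]
      simp only [finProdFinEquiv_apply_val]; ring)
    p hp
  have hset : (Finset.univ.filter fun q : Fin (D * (2 * M)) =>
      (if 0 ≤ p.eval (curveParam F q : ℝ) then 1 else -1 : ℤˣ) ≠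
        if Even (curveParam F q / (2 * M)) then 1 else -1) =
      Finset.univ.filter fun q => ℓ' (curvePoints n F q) ≠
        alternatingLabel n (2 * M) (curvePoints n F q) := by
    refine Finset.filter_congr fun q _ => ?_
    rw [← hw q, curvePoints, hsign, alternatingLabel_momentPoint hn]
  rw [hset, Finset.card_product, Finset.card_univ, Fintype.card_fin] at key
  have h1 : D * M ≤ 2 * (I.card * M) := by rw [← mul_assoc]; exact Nat.mul_le_mul_right _ hF
  have h2 : 8 * n ≤ 2 * (D * M) := by linarith
  set c := (Finset.univ.filter fun q => ℓ' (curvePoints n F q) ≠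
        alternatingLabel n (2 * M) (curvePoints n F q)).card
  have h3 : D * (2 * M) ≤ 8 * c := by
    have : D * (2 * M) = 2 * (D * M) := by ring
    omega
  have h4 : ((D * (2 * M) : ℕ) : ℝ) ≤ 8 * c := by exact_mod_cast h3
  linarith

theorem IsTester.mono {n m : ℕ} {C C' : (N : ℕ) → Set (Fin N → (Fin n → ℝ))} {ε ε' : ℝ}
    {A : ℕ → DecisionRule n m} (h : IsTester C ε A) (hC : ∀ N, C' N ⊆ C N) (hε : ε ≤ ε') :
    IsTester C' ε' A := fun N hN x hx ℓ =>
  ⟨(h N hN x (hC N hx) ℓ).1, fun hfar => (h N hN x (hC N hx) ℓ).2 fun ℓ' hℓ' =>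
    (mul_le_mul_of_nonneg_right hε (Nat.cast_nonneg N)).trans (hfar ℓ' hℓ')⟩

theorem acceptProb_le_one {n m N : ℕ} (A : DecisionRule n m) (x : Fin N → (Fin n → ℝ))
    (ℓ : (Fin n → ℝ) → ℤˣ) : acceptProb A x ℓ ≤ 1 := by
  refine div_le_one_of_le₀ ((Finset.sum_le_sum fun _ _ => (A _).2.2).trans_eq ?_) (by positivity)
  simp

theorem IndistinguishablePair.pow_le_of_isTester {k D M n m : ℕ}
    {μ ν : (Fin (2 * M) → Fin (2 * M)) → ℝ} (h : IndistinguishablePair k (2 * M) μ ν)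
    (hn : 0 < n) (hM : 0 < M) (hD : 0 < D) (hDL : D * (2 * M) ≤ 64 * n)
    (hDL' : 8 * n ≤ D * (2 * M)) {A : ℕ → DecisionRule n m}
    (hA : IsTester (pointSets n) (1 / 8) A) : D ^ k ≤ 8 * m ^ (k + 1) := by
  set acc : (Fin D → Fin (2 * M) → Fin (2 * M)) → ℝ := fun F =>
    acceptProb (A (D * (2 * M))) (curvePoints n F) (alternatingLabel n (2 * M)) with hacc
  have hN : 0 < D * (2 * M) := by positivity
  have htest := fun F : Fin D → Fin (2 * M) → Fin (2 * M) =>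
    hA _ hN (curvePoints n F) (curvePoints_injective hn F) (alternatingLabel n (2 * M))
  have hμ : 2 / 3 ≤ ∑ F, productWeight μ F * acc F := by
    have h1 : ∑ F : Fin D → Fin (2 * M) → Fin (2 * M), productWeight μ F * (2 / 3) = 2 / 3 := by
      rw [← Finset.sum_mul, sum_productWeight h.sum_left, one_mul]
    rw [← h1]
    refine Finset.sum_le_sum fun F _ => ?_
    by_cases hF : productWeight μ F = 0
    · simp [hF]
    · refine mul_le_mul_of_nonneg_left ((htest F).1 ?_) (productWeight_nonneg h.nonneg_left F)
      exact realizable_curvePoints hn (by omega) hDL fun i =>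
        h.card_image _ (Finset.prod_ne_zero_iff.1 hF i (Finset.mem_univ i))
  have hν : ∑ F, productWeight ν F * acc F ≤ 1 / 3 + 1 / 16 := by
    have h1 : ∀ F : Fin D → Fin (2 * M) → Fin (2 * M), productWeight ν F * acc F ≤
        productWeight ν F * (1 / 3) +
          if 2 * (Finset.univ.filter fun i => Function.Injective (F i)).card < D then
            productWeight ν F else 0 := by
      intro F
      have hw := productWeight_nonneg h.nonneg_right F
      split_ifs with hF
      · have := mul_le_of_le_one_right hw (acceptProb_le_one (A (D * (2 * M))) (curvePoints n F)
          (alternatingLabel n (2 * M)))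
        linarith
      · have := (htest F).2 (farFromRealizable_curvePoints hn hDL' (not_lt.1 hF))
        rw [add_zero]
        exact mul_le_mul_of_nonneg_left (by linarith) hw
    refine (Finset.sum_le_sum fun F _ => h1 F).trans ?_
    rw [Finset.sum_add_distrib, ← Finset.sum_mul, sum_productWeight h.sum_right, one_mul,
      ← Finset.sum_filter]
    exact add_le_add_right h.sum_productWeight_filter_le _
  have hsub := h.acceptProb_sub_le (n := n) hD (by omega) (A (D * (2 * M)))
    (alternatingLabel n (2 * M))
  have hle : (1 : ℝ) / 8 ≤ (m : ℝ) ^ (k + 1) / (D : ℝ) ^ k := by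
    refine le_trans ?_ hsub
    have := sub_le_sub hμ hν
    simp only [hacc] at this
    refine le_trans ?_ this
    norm_num
  rw [le_div_iff₀ (by positivity)] at hle
  have : (D : ℝ) ^ k ≤ 8 * (m : ℝ) ^ (k + 1) := by linarith
  exact_mod_cast this

/-- For each fixed `k`, testers need `n ^ (k / (k + 2))` samples for large `n`. -/
theorem eventually_pow_le_of_isTester (k : ℕ) : ∀ᶠ n : ℕ in atTop, ∀ (m : ℕ)
    (A : ℕ → DecisionRule n m), IsTester (pointSets n) (1 / 8) A → n ^ k ≤ m ^ (k + 2) := by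
  have hpair := exists_indistinguishablePair (k + 1)
  obtain ⟨M, hM⟩ : ∃ M, 64 ^ (k + 1 + 1) = 2 * M := ⟨32 * 64 ^ (k + 1), by ring⟩
  rw [hM] at hpair
  obtain ⟨μ, ν, h⟩ := hpair
  have hM0 : 0 < M := by
    have : 0 < 64 ^ (k + 1 + 1) := by positivity
    omega
  filter_upwards [eventually_ge_atTop (8 * (2 * M) ^ (k + 1)), eventually_ge_atTop (2 * M)]
    with n hn hn' m A hA
  have h1 : 64 * n / (2 * M) * (2 * M) ≤ 64 * n := Nat.div_mul_le_self _ _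
  have h2 : 64 * n < 64 * n / (2 * M) * (2 * M) + 2 * M := Nat.lt_div_mul_add (by omega)
  set D := 64 * n / (2 * M)
  have hD : 0 < D := by
    by_contra h0
    rw [Nat.eq_zero_of_not_pos h0] at h2
    omega
  have h3 := h.pow_le_of_isTester (by omega) hM0 hD h1 (by omega) hA
  have h4 : n ^ (k + 1) ≤ (D * (2 * M)) ^ (k + 1) := Nat.pow_le_pow_left (by omega) _
  have h5 : 8 * (2 * M) ^ (k + 1) * n ^ k ≤ 8 * (2 * M) ^ (k + 1) * m ^ (k + 2) := by
    calc _ ≤ n * n ^ k := Nat.mul_le_mul_right _ hn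
      _ = n ^ (k + 1) := by ring
      _ ≤ D ^ (k + 1) * (2 * M) ^ (k + 1) := by rwa [← mul_pow]
      _ ≤ 8 * m ^ (k + 1 + 1) * (2 * M) ^ (k + 1) := Nat.mul_le_mul_right _ h3
      _ = _ := by ring
  exact Nat.le_of_mul_le_mul_left h5 (by positivity)

theorem rpow_le_of_pow_le {n m k : ℕ} (h : n ^ k ≤ m ^ (k + 2)) :
    (n : ℝ) ^ (1 - 2 / ((k : ℝ) + 2)) ≤ m := by
  have hk : (0 : ℝ) < (k : ℝ) + 2 := by positivity
  refine le_of_pow_le_pow_left₀ (n := k + 2) (by omega) (Nat.cast_nonneg m) ?_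
  rw [← Real.rpow_mul_natCast (Nat.cast_nonneg n)]
  have : (1 - 2 / ((k : ℝ) + 2)) * ((k + 2 : ℕ) : ℝ) = (k : ℕ) := by
    push_cast; field_simp; ring
  rw [this, Real.rpow_natCast]
  exact_mod_cast h

/-- Countably many eventual properties hold up to an index that tends to infinity. -/
theorem exists_tendsto_atTop_eventually {P : ℕ → ℕ → Prop} (h : ∀ k, ∀ᶠ n in atTop, P k n) :
    ∃ κ : ℕ → ℕ, Tendsto κ atTop atTop ∧ ∀ᶠ n in atTop, P (κ n) n := by
  classical
  choose N hN using fun k => eventually_atTop.1 (h k)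
  refine ⟨fun n => Nat.findGreatest (fun k => N k ≤ n) n, tendsto_atTop.2 fun k => ?_, ?_⟩
  · filter_upwards [eventually_ge_atTop k, eventually_ge_atTop (N k)] with n h1 h2
    exact Nat.le_findGreatest h1 h2
  · filter_upwards [eventually_ge_atTop (N 0)] with n hn
    exact hN _ n (Nat.findGreatest_spec (P := fun k => N k ≤ n) (Nat.zero_le n) hn)

theorem mainTheorem9 :
    ∃ ε₀ : ℝ, 0 < ε₀ ∧ ∃ γ : ℕ → ℝ, Tendsto γ atTop (𝓝 0) ∧
      ∀ᶠ n : ℕ in atTop, ∀ ε : ℝ, 0 < ε → ε ≤ ε₀ →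
        ∀ (m : ℕ) (A : ℕ → DecisionRule n m),
          (IsTester (pointMultisets n) ε A → (n : ℝ) ^ (1 - γ n) ≤ (m : ℝ)) ∧
          (IsTester (pointSets n) ε A → (n : ℝ) ^ (1 - γ n) ≤ (m : ℝ)) := by
  obtain ⟨κ, hκ, hev⟩ := exists_tendsto_atTop_eventually eventually_pow_le_of_isTester
  refine ⟨1 / 8, by norm_num, fun n => 2 / ((κ n : ℝ) + 2), ?_, ?_⟩
  · exact tendsto_const_nhds.div_atTop
      (tendsto_atTop_add_const_right _ _ (tendsto_natCast_atTop_atTop.comp hκ))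
  · filter_upwards [hev] with n hn ε _ hε m A
    exact ⟨fun hA => rpow_le_of_pow_le (hn m A (hA.mono (fun _ => Set.subset_univ _) hε)),
      fun hA => rpow_le_of_pow_le (hn m A (hA.mono (fun _ => subset_rfl) hε))⟩
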